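/- For an orthonormal basis $b_1,\dots,b_n$ of $\mathbb{R}^n$ and $c\in\mathbb{R}^n$, let $Q_b(c)=\{x : |\langle b_i,x-c\rangle|\le \tfrac12 \text{ for all } i\}$ be the unit cube with centre $c$ and edges parallel to the $b_i$. The *cross* with centre $c$ and axes parallel to the $b_i$ is the union of the $2n+1$ unit cubes $Q_b(c)$ and $Q_b(c\pm b_i)$, $1\le i\le n$, i.e. of a unit cube and its reflections in all its faces. A *tiling of $\mathbb{R}^n$ by crosses* is a set of crosses, all translates of one another, that covers $\mathbb{R}^n$ and whose members have pairwise disjoint interiors; the centres are not required to be integral or to form a lattice. It is a *$Z$-tiling* if the axes of its crosses are parallel to the coordinate axes and all centres have integer coordinates, and a *lattice tiling* if the centres form a lattice in $\mathbb{R}^n$ (a discrete subgroup spanning $\mathbb{R}^n$). Two tilings are *congruent* if some isometry of $\mathbb{R}^n$ (translations included) maps the crosses of the first onto the crosses of the second. **Corollary.** Up to congruence there is exactly one tiling of $\mathbb{R}^5$ by crosses, and it is a lattice $Z$-tiling: there is a tiling $\mathcal{T}$ of $\mathbb{R}^5$ by crosses that is both a $Z$-tiling and a lattice tiling, and every tiling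 of $\mathbb{R}^5$ by crosses is congruent to $\mathcal{T}$. -/

import Mathlib

namespace CrossTiling

/-- Euclidean space `ℝⁿ`. -/
abbrev Space (n : ℕ) : Type := EuclideanSpace ℝ (Fin n)

/-- The (closed) unit cube with centre `c` whose edges are parallel to the vectors of the
orthonormal basis `b`. -/
def unitCube {n : ℕ} (b : OrthonormalBasis (Fin n) ℝ (Space n)) (c : Space n) : Set (Space n) :=
  {x | ∀ i, |inner ℝ (b i) (x - c)| ≤ 1 / 2}

/-- The cross with centre `c` and axes parallel to the vectors of `b`: the central unit cube
together with its reflections in all of its `2 * n` faces (these are the unit cubes with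
centres `c ± b i`). -/
def cross {n : ℕ} (b : OrthonormalBasis (Fin n) ℝ (Space n)) (c : Space n) : Set (Space n) :=
  unitCube b c ∪ ⋃ i, (unitCube b (c + b i) ∪ unitCube b (c - b i))

/-- The standard basis of `ℝⁿ`. -/
noncomputable abbrev stdBasis (n : ℕ) : OrthonormalBasis (Fin n) ℝ (Space n) :=
  EuclideanSpace.basisFun (Fin n) ℝ

/-- A tiling of `ℝⁿ` by crosses: a set of crosses, all translates of one another, which cover
`ℝⁿ` and have pairwise disjoint interiors. -/
structure IsCrossTiling {n : ℕ} (L : Set (Set (Space n))) : Prop where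
  isCross : ∃ b : OrthonormalBasis (Fin n) ℝ (Space n), ∀ K ∈ L, ∃ c, K = cross b c
  covers : ⋃₀ L = Set.univ
  disjoint : ∀ K ∈ L, ∀ K' ∈ L, K ≠ K' → Disjoint (interior K) (interior K')

/-- A `Z`-tiling: a tiling by crosses with axes parallel to the coordinate axes, all of whose
centres have integer coordinates. -/
structure IsZTiling {n : ℕ} (L : Set (Set (Space n))) : Prop where
  isCrossTiling : IsCrossTiling L
  integer : ∀ K ∈ L, ∃ c : Space n, (∀ i, ∃ m : ℤ, c i = (m : ℝ)) ∧ K = cross (stdBasis n) c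

/-- A lattice tiling: a tiling by crosses whose centres form a lattice (a discrete subgroup
of `ℝⁿ` that spans `ℝⁿ`). -/
structure IsLatticeTiling {n : ℕ} (L : Set (Set (Space n))) : Prop where
  isCrossTiling : IsCrossTiling L
  lattice : ∃ (b : OrthonormalBasis (Fin n) ℝ (Space n)) (Λ : Submodule ℤ (Space n)),
    ∃ _ : DiscreteTopology Λ, IsZLattice ℝ Λ ∧ L = cross b '' (Λ : Set (Space n))

/-- Two tilings are congruent if an isometry of `ℝⁿ` maps the tiles of the first one onto the
tiles of the second one. -/
def Congruent {n : ℕ} (L L' : Set (Set (Space n))) : Prop :=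
  ∃ g : Space n ≃ᵃⁱ[ℝ] Space n, (fun K : Set (Space n) => g '' K) '' L = L'

end CrossTiling

namespace CrossTiling

open Filter Topology

/-! In the basis of a tiling, let the closed crosses become half-open ones, so that the tiling
becomes an exact partition. Crosses meeting a common line parallel to axis `j` agree modulo one in
coordinate `j`, so rounding that coordinate down shifts each such line rigidly and keeps a
partition. Rounding all coordinates leaves a perfect code `T` in `ℤ⁵`: every point is uniquely a sum
of an element of `T` and one of the eleven elements of `ball 5`.

Perfect codes are linear up to translation. Let `W` be the sum of the ball in the group ring over
`ZMod q`, `q` prime. Frobenius turns `W ^ q` into the sum of the dilate `q • ball`, and `W * T = 1`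
counts the coverings by this dilate modulo `q` (`card_dilate_modEq`). For `q = 11` this gives period
eleven. By Dirichlet's theorem every nonzero class `k` modulo eleven contains a prime `q > 11`, so
the dilate of the ball by `k` also tiles modulo eleven. Counting over all `k`, the reduced code `U`
meets each coordinate line exactly once, and no two of its points differ by `k (e i ± e j)`. Seen as
a graph, `U` thus yields solutions of the toroidal queens problem of side eleven, all affine by a
finite search, and their slopes are constant, so `U` is a hyperplane `∑ a i * x i = d`.

The `a i` are nonzero and distinct up to sign, and there are five such classes modulo eleven: up to
a signed permutation of the axes they are `1, …, 5`. Linearity also makes the fractional parts of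
all corners agree, so the original tiling is a translate of the integral one. -/

/-! ### Toroidal queens on the board of side eleven -/

/-- The value `a` can be put in front of the list `l` of earlier values (latest first) without
being attacked on the torus of side eleven by a value at distance at least `d`. -/
def queenCompat (a : ℕ) : ℕ → List ℕ → Bool
  | _, [] => true
  | d, b :: l =>
    !(Nat.beq (a % 11) (b % 11)) && !(Nat.beq (a % 11) ((b + d) % 11)) &&
      !(Nat.beq ((a + d) % 11) (b % 11)) && queenCompat a (d + 1) l

/-- Every safe extension of `l` by `k` further values takes equidistant values. -/
def queenSearch : ℕ → List ℕ → Bool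
  -- Adding 11 keeps the natural-number difference of the first two values from truncating.
  | 0, l => (List.range 11).all fun i =>
      Nat.beq ((l.reverse.getD i 0) % 11) ((l.reverse.getD 0 0 +
        i * (l.reverse.getD 1 0 + 11 - l.reverse.getD 0 0)) % 11)
  | k + 1, l => (List.range 11).all fun a => !(queenCompat a 1 l) || queenSearch k (a :: l)

/-- Exhaustive backtracking; the first value may be taken to be 0 because adding a constant to a
solution gives a solution. -/
theorem queenSearch_ten : queenSearch 10 [0] = true := by decide +kernel

/-- The values `g (m - 1), …, g 0`. -/
def valuesBelow (g : ℕ → ℕ) : ℕ → List ℕ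
  | 0 => []
  | m + 1 => g m :: valuesBelow g m

theorem queenCompat_valuesBelow (g : ℕ → ℕ) (m : ℕ) (k d : ℕ) (hmk : k + d = m + 1)
    (h : ∀ i < k, ¬ g m ≡ g i [MOD 11] ∧ ¬ g m ≡ g i + (m - i) [MOD 11] ∧
      ¬ g m + (m - i) ≡ g i [MOD 11]) :
    queenCompat (g m) d (valuesBelow g k) = true := by
  induction k generalizing d with
  | zero => rfl
  | succ k ih =>
    have hk := h k (by omega)
    have hd : m - k = d := by omega
    rw [hd] at hk
    have := ih (d + 1) (by omega) fun i hi => h i (by omega)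
    simp only [valuesBelow, queenCompat, this, Bool.and_true, Bool.and_eq_true, Bool.not_eq_true',
      Bool.eq_false_iff, ne_eq, Nat.beq_eq]
    exact ⟨⟨hk.1, hk.2.1⟩, hk.2.2⟩

/-- A safe `g` passes every test along its own branch, so a successful search also succeeds at the
leaf it reaches. -/
theorem queenSearch_sound (g : ℕ → ℕ) (hlt : ∀ i, g i < 11)
    (h : ∀ m < 11, ∀ i < m, ¬ g m ≡ g i [MOD 11] ∧ ¬ g m ≡ g i + (m - i) [MOD 11] ∧
      ¬ g m + (m - i) ≡ g i [MOD 11]) (k m : ℕ) (hkm : k + m = 11)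
    (hs : queenSearch k (valuesBelow g m) = true) :
    queenSearch 0 (valuesBelow g 11) = true := by
  induction k generalizing m with
  | zero => obtain rfl : m = 11 := by omega
            exact hs
  | succ k ih =>
    refine ih (m + 1) (by omega) ?_
    have h1 := List.all_eq_true.1 hs (g m) (List.mem_range.2 (hlt m))
    rwa [queenCompat_valuesBelow g m m 1 rfl (h m (by omega))] at h1

/-- Solutions of the toroidal queens problem of side eleven are affine. -/
theorem affine_of_toroidal_queens (f : ZMod 11 → ZMod 11) (hf : Function.Injective f)
    (hadd : Function.Injective fun x => f x + x) (hsub : Function.Injective fun x => f x - x)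
    (x : ZMod 11) : f x = f 0 + x * (f 1 - f 0) := by
  set g : ℕ → ℕ := fun i => (f i - f 0).val with hg
  have hgc : ∀ i, ((g i : ℕ) : ZMod 11) = f i - f 0 := fun i => by simp [hg]
  have key : ∀ m < 11, ∀ i < m, ¬ g m ≡ g i [MOD 11] ∧ ¬ g m ≡ g i + (m - i) [MOD 11] ∧
      ¬ g m + (m - i) ≡ g i [MOD 11] := by
    intro m hm i hi
    have hne : ((m : ℕ) : ZMod 11) ≠ (i : ℕ) := by
      intro h
      rw [ZMod.natCast_eq_natCast_iff] at h
      have := h.eq_of_lt_of_lt hm (hi.trans hm)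
      omega
    simp only [← ZMod.natCast_eq_natCast_iff, Nat.cast_add, Nat.cast_sub hi.le, hgc]
    refine ⟨fun h => hne (hf ?_), fun h => hne (hsub ?_), fun h => hne (hadd ?_)⟩ <;>
    linear_combination h
  have h0 : valuesBelow g 1 = [0] := by simp [valuesBelow, hg]
  have := queenSearch_sound g (fun i => ZMod.val_lt _) key 10 1 rfl
    (by rw [h0]; exact queenSearch_ten)
  have h1 := List.all_eq_true.1 this x.val (List.mem_range.2 (ZMod.val_lt x))
  have hget : (valuesBelow g 11).reverse = (List.range 11).map g := rfl
  have hx : x.val < 11 := ZMod.val_lt x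
  have e0 : g 0 = 0 := by simp [hg]
  have h2 := Nat.eq_of_beq_eq_true h1
  rw [hget] at h2
  simp only [List.getD_eq_getElem?_getD, List.getElem?_map, List.getElem?_range hx,
    List.getElem?_range (show 0 < 11 by norm_num), List.getElem?_range (show 1 < 11 by norm_num),
    Option.map_some, Option.getD_some, e0] at h2
  have h3 := (ZMod.natCast_eq_natCast_iff _ _ 11).2 h2
  have e11 : (11 : ZMod 11) = 0 := by decide
  push_cast at h3
  rw [hgc, hgc, e11] at h3
  simp only [ZMod.natCast_val, ZMod.cast_id', id, Nat.cast_one] at h3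
  linear_combination h3

/-! ### Dilating the prototile of a tiling of an abelian group -/

section Dilation

variable {G : Type*} [AddCommGroup G] (q : ℕ) (T : Set G)

open Classical in
/-- The linear functional on the group ring that counts the representations of `x` as a sum of an
element of `T` and an element of the support. -/
noncomputable def representations (x : G) : AddMonoidAlgebra (ZMod q) G →ₗ[ZMod q] ZMod q :=
  Finsupp.linearCombination (ZMod q) (fun g => if x - g ∈ T then (1 : ZMod q) else 0) ∘ₗ
    (AddMonoidAlgebra.coeffLinearEquiv (ZMod q)).toLinearMap

open Classical in
theorem representations_single (x g : G) (r : ZMod q) :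
    representations q T x (AddMonoidAlgebra.single g r) = if x - g ∈ T then r else 0 := by
  simp [representations]

theorem representations_single_mul (x g : G) (P : AddMonoidAlgebra (ZMod q) G) :
    representations q T x (AddMonoidAlgebra.single g 1 * P) = representations q T (x - g) P := by
  induction P using AddMonoidAlgebra.induction_linear with
  | zero => simp
  | add P Q hP hQ => rw [mul_add, map_add, map_add, hP, hQ]
  | single h r =>
    rw [AddMonoidAlgebra.single_mul_single, representations_single, representations_single,
      one_mul, sub_sub]

open Classical in
/-- If the translates of `V` by the elements of `T` tile an abelian group, then the number of
translates of the dilate `q • V` that contain a given point is known modulo the prime `q`. -/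
theorem card_dilate_modEq [Fact q.Prime] (V : Finset G)
    (hT : ∀ x, (V.filter fun v => x - v ∈ T).card = 1) (x : G) :
    (((V.filter fun v => x - q • v ∈ T).card : ℕ) : ZMod q) = (V.card : ZMod q) ^ (q - 1) := by
  set W : AddMonoidAlgebra (ZMod q) G := ∑ v ∈ V, AddMonoidAlgebra.single v 1 with hW
  have : CharP (AddMonoidAlgebra (ZMod q) G) q :=
    charP_of_injective_algebraMap (FaithfulSMul.algebraMap_injective (ZMod q) _) q
  -- Frobenius in characteristic `q`.
  have hpow : W ^ q = ∑ v ∈ V, AddMonoidAlgebra.single (q • v) 1 := by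
    rw [hW, sum_pow_char]
    exact Finset.sum_congr rfl fun v _ => by rw [AddMonoidAlgebra.single_pow, one_pow]
  -- `T` may be infinite, so its product with `W ^ (k + 1)` is read off through the functional: the
  -- first factor `W` gives 1 everywhere, each further one multiplies by the size of `V`.
  have hind : ∀ k y, representations q T y (W ^ (k + 1)) = (V.card : ZMod q) ^ k := by
    intro k
    induction k with
    | zero =>
      intro y
      simp only [hW, zero_add, pow_one, map_sum, representations_single, Finset.sum_boole, hT,
        pow_zero, Nat.cast_one]
    | succ k ih =>
      intro y
      rw [pow_succ' W, hW, Finset.sum_mul, map_sum]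
      simp only [representations_single_mul]
      rw [← hW, Finset.sum_congr rfl fun v _ => ih (y - v)]
      rw [Finset.sum_const, nsmul_eq_mul, pow_succ']
  have h := hind (q - 1) x
  rw [Nat.sub_add_cancel (Fact.out (p := q.Prime)).one_lt.le, hpow, map_sum] at h
  simpa only [representations_single, Finset.sum_boole] using h

end Dilation

/-! ### Functions on a product that do not change along coordinate lines -/

theorem eq_add_sum_of_add_single {ι A M : Type*} [Fintype ι] [DecidableEq ι] [AddCommMonoid A]
    [AddCommMonoid M] (f : (ι → A) → M) (g : ι → A → M)
    (h : ∀ x i a, f (x + Pi.single i a) = f x + g i a) (x : ι → A) :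
    f x = f 0 + ∑ i, g i (x i) := by
  have key : ∀ s : Finset ι, f (∑ i ∈ s, Pi.single i (x i)) = f 0 + ∑ i ∈ s, g i (x i) := by
    intro s
    induction s using Finset.induction_on with
    | empty => simp
    | insert i s hi ih =>
      rw [Finset.sum_insert hi, Finset.sum_insert hi, add_comm, h, ih, add_assoc,
        add_comm (g i (x i))]
  have := key Finset.univ
  rwa [Finset.univ_sum_single] at this

theorem eq_of_add_single_eq {ι A β : Type*} [Fintype ι] [DecidableEq ι] [AddCommMonoid A]
    (f : (ι → A) → β) (h : ∀ x i a, f (x + Pi.single i a) = f x) (x : ι → A) : f x = f 0 := by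
  have key : ∀ s : Finset ι, f (∑ i ∈ s, Pi.single i (x i)) = f 0 := by
    intro s
    induction s using Finset.induction_on with
    | empty => simp
    | insert i s hi ih => rw [Finset.sum_insert hi, add_comm, h, ih]
  have := key Finset.univ
  rwa [Finset.univ_sum_single] at this

theorem eq_of_add_single_one_eq {ι β : Type*} [Fintype ι] [DecidableEq ι]
    (f : (ι → ℤ) → β) (h : ∀ x i, f (x + Pi.single i 1) = f x) (x : ι → ℤ) : f x = f 0 := by
  refine eq_of_add_single_eq f (fun x i a => ?_) x
  induction a using Int.induction_on with
  | zero => simp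
  | succ a ih => rw [Pi.single_add, ← add_assoc, h, ih]
  | pred a ih =>
    have h1 := h (x + Pi.single i (-(a : ℤ) - 1)) i
    rwa [add_assoc, ← Pi.single_add, sub_add_cancel, ih, eq_comm] at h1

/-! ### Codes over the field with eleven elements -/

/-- A set of points over the field with eleven elements that meets each coordinate line exactly
once, and in which no two points differ by a multiple of `e i ± e j`, is a hyperplane. -/
theorem exists_hyperplane {n : ℕ} [NeZero n] (U : Set (Fin n → ZMod 11))
    (hline : ∀ (x : Fin n → ZMod 11) i, ∃! t : ZMod 11, x + Pi.single i t ∈ U)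
    (hdiag : ∀ x ∈ U, ∀ i j, i ≠ j → ∀ k : ZMod 11, k ≠ 0 →
      x + Pi.single i k + Pi.single j k ∉ U ∧ x + Pi.single i k + Pi.single j (-k) ∉ U) :
    ∃ (a : Fin n → ZMod 11) (d : ZMod 11), (∀ x, x ∈ U ↔ ∑ i, a i * x i = d) ∧
      (∀ i, a i ≠ 0) ∧ ∀ i j, i ≠ j → a i ≠ a j ∧ a i ≠ -a j := by
  have huniq : ∀ (x : Fin n → ZMod 11) i (s t : ZMod 11), x + Pi.single i s ∈ U → x + Pi.single i t ∈ U → s = t :=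
    fun x i s t hs ht => (hline x i).unique hs ht
  -- `h x` is the displacement along axis 0 that carries `x` into `U`.
  choose h hmem using fun x => (hline x 0).exists
  have hiff : ∀ (x : Fin n → ZMod 11) (t : ZMod 11), x + Pi.single 0 t ∈ U ↔ h x = t := fun x t =>
    ⟨fun ht => huniq x 0 _ _ (hmem x) ht, fun ht => ht ▸ hmem x⟩
  have hzero : ∀ (x : Fin n → ZMod 11) (t : ZMod 11), h (x + Pi.single 0 t) = h x - t := by
    intro x t
    rw [← hiff, add_assoc, ← Pi.single_add, add_sub_cancel]
    exact hmem x
  set s : Fin n → (Fin n → ZMod 11) → ZMod 11 := fun j x => h (x + Pi.single j 1) - h x with hs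
  have hs0 : ∀ x, s 0 x = -1 := fun x => by simp [hs, hzero]
  have hinj : ∀ j, j ≠ 0 → ∀ (x : Fin n → ZMod 11), Function.Injective fun t : ZMod 11 => h (x + Pi.single j t) := by
    intro j hj x t t' htt
    refine huniq (x + Pi.single 0 (h (x + Pi.single j t))) j t t' ?_ ?_
    · rw [add_right_comm, hiff]
    · rw [add_right_comm, hiff]; exact htt.symm
  have hdiff : ∀ j, j ≠ 0 → ∀ (x : Fin n → ZMod 11) (t t' : ZMod 11), t ≠ t' →
      h (x + Pi.single j t') - h (x + Pi.single j t) ≠ t' - t ∧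
      h (x + Pi.single j t') - h (x + Pi.single j t) ≠ -(t' - t) := by
    intro j hj x t t' htt
    have h1 := hdiag _ (hmem (x + Pi.single j t)) j 0 hj (t' - t) (sub_ne_zero.2 htt.symm)
    have e : ∀ c : ZMod 11, x + Pi.single j t + Pi.single 0 (h (x + Pi.single j t)) + Pi.single j (t' - t)
        + Pi.single 0 c = x + Pi.single j t' + Pi.single 0 (h (x + Pi.single j t) + c) := by
      intro c
      rw [Pi.single_add, Pi.single_sub]
      abel
    rw [e, e, hiff, hiff] at h1
    exact ⟨fun h2 => h1.1 (by rw [← h2]; ring), fun h2 => h1.2 (by rw [← h2]; ring)⟩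
  have haff : ∀ j (x : Fin n → ZMod 11) (t : ZMod 11), h (x + Pi.single j t) = h x + t * s j x := by
    intro j x t
    by_cases hj : j = 0
    · rw [hj, hs0, hzero]; ring
    -- On each line in direction `j`, `h` solves the toroidal queens problem.
    · have h1 := affine_of_toroidal_queens (fun t => h (x + Pi.single j t)) (hinj j hj x)
        (fun t t' htt => by
          by_contra hne
          exact (hdiff j hj x t t' hne).2 (by linear_combination -htt))
        (fun t t' htt => by
          by_contra hne
          exact (hdiff j hj x t t' hne).1 (by linear_combination -htt)) t
      simpa using h1
  have hsne : ∀ j x, s j x ≠ 0 := by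
    intro j x h0
    by_cases hj : j = 0
    · rw [hj, hs0] at h0
      exact absurd h0 (by decide)
    · have h1 : h (x + Pi.single j 1) = h (x + Pi.single j 0) := by
        rw [Pi.single_zero, add_zero, haff, h0, mul_zero, add_zero]
      exact absurd (hinj j hj x h1) (by decide)
  have hconst : ∀ j x, s j x = s j 0 := by
    intro j
    refine eq_of_add_single_eq (s j) fun x i m => ?_
    -- The increment of `h` over a rectangle, computed along both pairs of sides. A nonzero mixed
    -- difference would make the slope in direction `j` vanish somewhere on a line in direction `i`.
    have hcomm : ∀ t m : ZMod 11, m * s i x + t * s j (x + Pi.single i m)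
        = t * s j x + m * s i (x + Pi.single j t) := by
      intro t m
      have h1 := haff j (x + Pi.single i m) t
      have h2 := haff i (x + Pi.single j t) m
      rw [add_right_comm, h2, haff, haff] at h1
      linear_combination -h1
    have hlin : ∀ m : ZMod 11, s j (x + Pi.single i m) = s j x + m * (s i (x + Pi.single j 1) - s i x) :=
      fun m => by linear_combination hcomm 1 m
    by_cases hC : s i (x + Pi.single j 1) - s i x = 0
    · rw [hlin, hC, mul_zero, add_zero]
    · have : Fact (Nat.Prime 11) := ⟨by norm_num⟩
      refine absurd ?_ (hsne j (x + Pi.single i (-s j x / (s i (x + Pi.single j 1) - s i x))))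
      rw [hlin, div_mul_cancel₀ _ hC, add_neg_cancel]
  have hform : ∀ x, h x = h 0 + ∑ i, s i 0 * x i :=
    eq_add_sum_of_add_single h (fun i t => s i 0 * t) fun x i t => by
      rw [haff, hconst, mul_comm]
  have hU : ∀ x, x ∈ U ↔ ∑ i, s i 0 * x i = -h 0 := by
    intro x
    have h1 := hiff x 0
    rw [Pi.single_zero, add_zero, hform] at h1
    rw [h1, add_comm, add_eq_zero_iff_eq_neg]
  refine ⟨fun i => s i 0, -h 0, hU, fun i => hsne i 0, fun i j hij => ?_⟩
  have hadd : ∀ (x : Fin n → ZMod 11) (i : Fin n) (t : ZMod 11),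
      ∑ l, s l 0 * (x + Pi.single i t : Fin n → ZMod 11) l = ∑ l, s l 0 * x l + s i 0 * t := by
    intro x i t
    simp [mul_add, Finset.sum_add_distrib, Pi.single_apply]
  obtain ⟨y, hy⟩ : ∃ y, y ∈ U := ⟨_, hmem 0⟩
  have h1 := hdiag y hy i j hij 1 (by decide)
  rw [hU, hU, hadd, hadd, hadd, hadd, (hU y).1 hy] at h1
  exact ⟨fun h3 => h1.2 (by linear_combination h3), fun h3 => h1.1 (by linear_combination h3)⟩

/-! ### Perfect codes in the integer lattice -/

/-- The centres of the cubes of the integral cross with centre `0`. -/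
def ball (n : ℕ) : Finset (Fin n → ℤ) :=
  insert 0 (Finset.univ.image (fun i => Pi.single i 1) ∪
    Finset.univ.image (fun i => Pi.single i (-1)))

theorem mem_ball {n : ℕ} {v : Fin n → ℤ} :
    v ∈ ball n ↔ v = 0 ∨ ∃ i, v = Pi.single i 1 ∨ v = Pi.single i (-1) := by
  simp only [ball, Finset.mem_insert, Finset.mem_union, Finset.mem_image, Finset.mem_univ,
    true_and, ← exists_or, eq_comm (a := v)]

theorem zero_mem_ball {n : ℕ} : 0 ∈ ball n := mem_ball.2 (Or.inl rfl)

theorem single_one_mem_ball {n : ℕ} (i : Fin n) : Pi.single i 1 ∈ ball n :=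
  mem_ball.2 (Or.inr ⟨i, Or.inl rfl⟩)

theorem single_neg_one_mem_ball {n : ℕ} (i : Fin n) : Pi.single i (-1) ∈ ball n :=
  mem_ball.2 (Or.inr ⟨i, Or.inr rfl⟩)

theorem single_inj_left {n : ℕ} {i j : Fin n} {a b : ℤ} (ha : a ≠ 0)
    (h : (Pi.single i a : Fin n → ℤ) = Pi.single j b) : i = j ∧ a = b := by
  have h1 := congrFun h i
  rw [Pi.single_eq_same, Pi.single_apply] at h1
  split_ifs at h1 with hij
  · exact ⟨hij, h1⟩
  · exact absurd h1 ha

theorem sum_ball {n : ℕ} {M : Type*} [AddCommMonoid M] (f : (Fin n → ℤ) → M) :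
    ∑ v ∈ ball n, f v = f 0 + ∑ i, (f (Pi.single i 1) + f (Pi.single i (-1))) := by
  have h1 : Function.Injective fun i : Fin n => (Pi.single i 1 : Fin n → ℤ) :=
    fun i j h => (single_inj_left one_ne_zero h).1
  have h2 : Function.Injective fun i : Fin n => (Pi.single i (-1) : Fin n → ℤ) :=
    fun i j h => (single_inj_left (by decide) h).1
  rw [ball, Finset.sum_insert, Finset.sum_union, Finset.sum_image h1.injOn,
    Finset.sum_image h2.injOn, Finset.sum_add_distrib]
  · rw [Finset.disjoint_left]
    intro v hv hv'
    obtain ⟨i, -, rfl⟩ := Finset.mem_image.1 hv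
    obtain ⟨j, -, h⟩ := Finset.mem_image.1 hv'
    exact absurd (single_inj_left (by decide) h).2 (by decide)
  · simp

theorem card_ball (n : ℕ) : (ball n).card = 2 * n + 1 := by
  rw [Finset.card_eq_sum_ones, sum_ball]
  simp
  ring

/-- Reduction modulo eleven, coordinate by coordinate. -/
def modEleven {n : ℕ} : (Fin n → ℤ) →+ (Fin n → ZMod 11) where
  toFun x i := x i
  map_zero' := by ext; simp
  map_add' x y := by ext; simp

theorem modEleven_single {n : ℕ} (i : Fin n) (k : ℤ) :
    modEleven (Pi.single i k) = Pi.single i (k : ZMod 11) := by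
  ext j
  simp only [modEleven, AddMonoidHom.coe_mk, ZeroHom.coe_mk, Pi.single_apply]
  split_ifs <;> simp

theorem modEleven_surjective {n : ℕ} : Function.Surjective (modEleven (n := n)) :=
  fun y => ⟨fun i => (y i).cast, by ext i; simp [modEleven]⟩

open Classical in
/-- A perfect code in `ℤ⁵` is periodic with period eleven in each coordinate. -/
theorem perfect_code_periodic (T : Set (Fin 5 → ℤ))
    (hT : ∀ x, ((ball 5).filter fun v => x - v ∈ T).card = 1) (x y : Fin 5 → ℤ) :
    x + 11 • y ∈ T ↔ x ∈ T := by
  have : Fact (Nat.Prime 11) := ⟨by norm_num⟩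
  have hstep : ∀ x, ∀ v ∈ ball 5, x - 11 • v ∈ T ↔ x ∈ T := by
    intro x v hv
    have h1 := card_dilate_modEq 11 T (ball 5) hT x
    -- The count is a multiple of eleven and at most eleven: all the points `x - 11 • v` lie in `T`
    -- or none does, and `v = 0` decides which.
    rw [card_ball, show ((2 * 5 + 1 : ℕ) : ZMod 11) = 0 from ZMod.natCast_self 11, zero_pow (by norm_num),
      ZMod.natCast_eq_zero_iff] at h1
    have hle := Finset.card_filter_le (ball 5) fun v => x - 11 • v ∈ T
    rw [card_ball] at hle
    have h0 := zero_mem_ball (n := 5)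
    rcases Nat.eq_zero_or_pos ((ball 5).filter fun v => x - 11 • v ∈ T).card with h | h
    · rw [Finset.card_eq_zero, Finset.filter_eq_empty_iff] at h
      have := h h0
      rw [smul_zero, sub_zero] at this
      exact iff_of_false (h hv) this
    · have h2 := Nat.le_of_dvd h h1
      have h3 := (Finset.card_filter_eq_iff (s := ball 5)).1
        (le_antisymm (Finset.card_filter_le _ _) (by rw [card_ball]; exact h2))
      have := h3 0 h0
      rw [smul_zero, sub_zero] at this
      exact iff_of_true (h3 v hv) this
  have h1 := eq_of_add_single_one_eq (fun y => x + 11 • y ∈ T) (fun y i => by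
    have := hstep (x + 11 • y) _ (single_neg_one_mem_ball i)
    rw [Pi.single_neg, smul_neg, sub_neg_eq_add] at this
    rw [smul_add, ← add_assoc]
    exact propext this) y
  simpa using h1

/-- Double counting: replacing `k` by `-k` permutes `K`, so both terms of `hf` contribute equally.
-/
theorem two_mul_sum_of_symmetric {ι κ : Type*} [Fintype ι] [InvolutiveNeg κ] (K : Finset κ)
    (hK : ∀ k ∈ K, -k ∈ K) (f : ι → κ → ℕ) (hf : ∀ k ∈ K, ∑ i, (f i k + f i (-k)) = 1) :
    2 * ∑ i, ∑ k ∈ K, f i k = K.card := by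
  have hneg : ∀ i, ∑ k ∈ K, f i (-k) = ∑ k ∈ K, f i k := fun i =>
    Finset.sum_nbij' (fun k => -k) (fun k => -k) hK hK (fun k _ => neg_neg k)
      (fun k _ => neg_neg k) fun k _ => rfl
  rw [Finset.card_eq_sum_ones, ← Finset.sum_congr rfl hf, Finset.sum_comm (s := K), Finset.mul_sum]
  refine Finset.sum_congr rfl fun i _ => ?_
  rw [Finset.sum_add_distrib, hneg, two_mul]

open Classical in
/-- All perfect codes in `ℤ⁵` are linear, up to a translation. -/
theorem perfect_code_linear (T : Set (Fin 5 → ℤ))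
    (hT : ∀ x, ((ball 5).filter fun v => x - v ∈ T).card = 1) :
    ∃ (a : Fin 5 → ZMod 11) (d : ZMod 11), (∀ x : Fin 5 → ℤ, x ∈ T ↔ ∑ i, a i * x i = d) ∧
      (∀ i, a i ≠ 0) ∧ ∀ i j, i ≠ j → a i ≠ a j ∧ a i ≠ -a j := by
  set U : Set (Fin 5 → ZMod 11) := modEleven '' T with hU
  have hTU : ∀ x, modEleven x ∈ U ↔ x ∈ T := by
    refine fun x => ⟨?_, fun h => ⟨x, h, rfl⟩⟩
    rintro ⟨t, ht, htx⟩
    have hdvd : ∀ i, ∃ k, x i = t i + 11 * k := by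
      intro i
      have h1 : ((t i : ℤ) : ZMod 11) = (x i : ℤ) := congrFun htx i
      rw [ZMod.intCast_eq_intCast_iff_dvd_sub] at h1
      obtain ⟨k, hk⟩ := h1
      exact ⟨k, by push_cast at hk; linarith⟩
    choose y hy using hdvd
    have hx : x = t + 11 • y := by ext i; simp [hy]
    rw [hx]
    exact (perfect_code_periodic T hT t y).2 ht
  have hone : ∀ k : ZMod 11, k ≠ 0 → ∀ y : Fin 5 → ZMod 11,
      ((ball 5).filter fun v => y - k • modEleven v ∈ U).card = 1 := by
    intro k hk y
    have : Fact (Nat.Prime 11) := ⟨by norm_num⟩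
    -- Dirichlet's theorem. Since `q > 11`, a count of at most eleven that is 1 modulo `q` equals 1.
    obtain ⟨q, hq11, hq, hqk⟩ := Nat.forall_exists_prime_gt_and_eq_mod (isUnit_iff_ne_zero.2 hk) 11
    have : Fact q.Prime := ⟨hq⟩
    obtain ⟨x, rfl⟩ := modEleven_surjective y
    have h1 := card_dilate_modEq q T (ball 5) hT x
    have h11 : ((11 : ℕ) : ZMod q) ≠ 0 := by
      rw [Ne, ZMod.natCast_eq_zero_iff]
      exact fun h => absurd (Nat.le_of_dvd (by norm_num) h) (by omega)
    rw [card_ball, ZMod.pow_card_sub_one_eq_one h11, ← Nat.cast_one,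
      ZMod.natCast_eq_natCast_iff] at h1
    have hle := Finset.card_filter_le (ball 5) fun v => x - q • v ∈ T
    rw [card_ball] at hle
    rw [← h1.eq_of_lt_of_lt (by omega) (by omega)]
    congr 1
    refine Finset.filter_congr fun v _ => ?_
    rw [← hTU, map_sub, map_nsmul, ← hqk, Nat.cast_smul_eq_nsmul]
  have hpair : ∀ k : ZMod 11, k ≠ 0 → ∀ y : Fin 5 → ZMod 11, ∀ v ∈ ball 5, ∀ w ∈ ball 5,
      y - k • modEleven v ∈ U → y - k • modEleven w ∈ U → v = w := fun k hk y v hv w hw h1 h2 =>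
    Finset.card_le_one.1 (hone k hk y).le v (Finset.mem_filter.2 ⟨hv, h1⟩) w
      (Finset.mem_filter.2 ⟨hw, h2⟩)
  have hsm : ∀ (k : ZMod 11) (i : Fin 5),
      k • modEleven (Pi.single i 1 : Fin 5 → ℤ) = Pi.single i k := fun k i => by
    rw [modEleven_single, ← Pi.single_smul]; simp
  have hsm' : ∀ (k : ZMod 11) (i : Fin 5),
      k • modEleven (Pi.single i (-1) : Fin 5 → ℤ) = -Pi.single i k := fun k i => by
    rw [modEleven_single, ← Pi.single_smul, ← Pi.single_neg]; simp
  have hsub : ∀ (y : Fin 5 → ZMod 11) i, ∀ s t : ZMod 11,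
      y + Pi.single i s ∈ U → y + Pi.single i t ∈ U → s = t := by
    intro y i s t h1 h2
    by_contra hne
    have := hpair (t - s) (sub_ne_zero.2 (Ne.symm hne)) (y + Pi.single i t) 0 zero_mem_ball
      _ (single_one_mem_ball i) (by simpa using h2)
      (by rw [hsm, Pi.single_sub, add_sub_assoc, sub_sub_cancel]; exact h1)
    exact absurd (congrFun this i) (by simp)
  have hline : ∀ (y : Fin 5 → ZMod 11) i, ∃! t : ZMod 11, y + Pi.single i t ∈ U := by
    intro y i
    refine existsUnique_of_exists_of_unique ?_ fun s t => hsub y i s t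
    by_cases hy : y ∈ U
    · exact ⟨0, by simpa using hy⟩
    -- `N i` counts the points of `U` on the line through `y` in direction `i`. Each is at most 1,
    -- and the ten dilates give `2 * ∑ N i = 10`, so all five equal 1.
    set N : Fin 5 → ℕ := fun i =>
      ∑ k ∈ Finset.univ.erase (0 : ZMod 11), if y + Pi.single i k ∈ U then 1 else 0 with hN
    have hNle : ∀ i, N i ≤ 1 := by
      intro i
      rw [hN]
      simp only [Finset.sum_boole]
      exact Finset.card_le_one.2 fun s hs t ht =>
        hsub y i s t (Finset.mem_filter.1 hs).2 (Finset.mem_filter.1 ht).2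
    have hsum : 2 * ∑ i, N i = 10 := by
      refine two_mul_sum_of_symmetric _ (by simp) (fun i k =>
        if y + Pi.single i k ∈ U then 1 else 0) fun k hk => ?_
      have h1 := hone k (Finset.ne_of_mem_erase hk) y
      simp only [Finset.card_filter, sum_ball, hsm, hsm', map_zero, smul_zero, sub_zero, if_neg hy,
        zero_add, sub_neg_eq_add] at h1
      refine (Finset.sum_congr rfl fun i _ => ?_).trans h1
      rw [Pi.single_neg, ← sub_eq_add_neg, add_comm]
    have hNi : N i ≠ 0 := by
      intro h0
      have h1 : ∑ j, N j ≤ ∑ j, if j = i then 0 else 1 := Finset.sum_le_sum fun j _ => by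
        split_ifs with hj
        · rw [hj, h0]
        · exact hNle j
      have h2 : (∑ j : Fin 5, if j = i then 0 else 1) = 4 := by
        clear * -; revert i; decide
      omega
    obtain ⟨k, -, hk⟩ := Finset.exists_ne_zero_of_sum_ne_zero hNi
    exact ⟨k, by_contra fun h => hk (if_neg h)⟩
  have hdiag : ∀ x ∈ U, ∀ i j, i ≠ j → ∀ k : ZMod 11, k ≠ 0 →
      x + Pi.single i k + Pi.single j k ∉ U ∧ x + Pi.single i k + Pi.single j (-k) ∉ U := by
    refine fun x hx i j hij k hk => ⟨fun h => ?_, fun h => ?_⟩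
    · have := hpair k hk (x + Pi.single i k) _ (single_one_mem_ball i) _ (single_neg_one_mem_ball j)
        (by rw [hsm, add_sub_cancel_right]; exact hx) (by rw [hsm', sub_neg_eq_add]; exact h)
      exact hij (single_inj_left one_ne_zero this).1
    · have := hpair k hk (x + Pi.single i k) _ (single_one_mem_ball i) _ (single_one_mem_ball j)
        (by rw [hsm, add_sub_cancel_right]; exact hx)
        (by rw [hsm, sub_eq_add_neg, ← Pi.single_neg]; exact h)
      exact hij (single_inj_left one_ne_zero this).1
  obtain ⟨a, d, h⟩ := exists_hyperplane U hline hdiag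
  exact ⟨a, d, fun x => by rw [← hTU, h.1]; rfl, h.2⟩

/-! ### Tilings by half-open crosses with arbitrary real corners -/

/-- The half-open cross whose central cube has smallest corner `c` contains `x`. -/
def Covers {n : ℕ} (c x : Fin n → ℝ) : Prop := (fun i => ⌊x i - c i⌋) ∈ ball n

/-- The half-open crosses with smallest central corners `c k` partition the space. -/
def IsPartition {n : ℕ} {ι : Type*} (c : ι → Fin n → ℝ) : Prop := ∀ x, ∃! k, Covers (c k) x

/-- If the line is partitioned into half-open intervals of length one, and `l s` is the left end
of the interval that contains `s`, then all left ends are congruent modulo one. -/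
theorem exists_int_of_unit_intervals (l : ℝ → ℝ) (h1 : ∀ s, l s ≤ s) (h2 : ∀ s, s < l s + 1)
    (h3 : ∀ s t, l s ≤ t → t < l s + 1 → l t = l s) (s t : ℝ) : ∃ m : ℤ, l t = l s + m := by
  have hidem : ∀ s, l (l s) = l s := fun s => h3 s _ le_rfl (by linarith)
  have hsucc : ∀ a, l a = a → l (a + 1) = a + 1 := by
    intro a ha
    have hb1 := h1 (a + 1)
    have hb2 := h2 (a + 1)
    by_contra hne
    have hlt := lt_of_le_of_ne hb1 hne
    have := h3 a (l (a + 1)) (by linarith) (by linarith)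
    rw [hidem] at this
    linarith
  have hpred : ∀ a, l a = a → l (a - 1) = a - 1 := by
    intro a ha
    have hb1 := h1 (a - 1)
    have hb2 := h2 (a - 1)
    have hb := hsucc _ (hidem (a - 1))
    have := h3 (l (a - 1) + 1) a (by linarith) (by linarith)
    linarith
  have hint : ∀ m : ℤ, l (l s + m) = l s + m := by
    intro m
    induction m using Int.induction_on with
    | zero => simpa using hidem s
    | succ m ih => push_cast at ih ⊢; rw [← add_assoc]; exact hsucc _ ih
    | pred m ih => push_cast at ih ⊢; rw [← add_sub_assoc]; exact hpred _ ih
  refine ⟨⌊t - l s⌋, ?_⟩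
  have hf1 := Int.floor_le (t - l s)
  have hf2 := Int.lt_floor_add_one (t - l s)
  rw [h3 (l s + ⌊t - l s⌋) t (by rw [hint]; linarith) (by rw [hint]; linarith), hint]

/-- In a partition into half-open crosses, the positions of the crosses that meet a given line
parallel to a coordinate axis agree modulo one in the direction of the line. -/
theorem IsPartition.fract_eq {n : ℕ} {ι : Type*} {c : ι → Fin n → ℝ} (hc : IsPartition c)
    (j : Fin n) (x : Fin n → ℝ) {s t : ℝ} {k k' : ι} (hk : Covers (c k) (x + Pi.single j s))
    (hk' : Covers (c k') (x + Pi.single j t)) : Int.fract (c k j) = Int.fract (c k' j) := by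
  choose K hK hKu using fun s : ℝ => hc (x + Pi.single j s)
  simp only at hK hKu
  -- The left end of the unit interval around `s` in which one cube of the cross `K s` meets the
  -- line.
  set l : ℝ → ℝ := fun s => s - Int.fract (x j + s - c (K s) j) with hl
  have hloc : ∀ s t, l s ≤ t → t < l s + 1 → l t = l s := by
    intro s t h1 h2
    have hfl : ⌊x j + t - c (K s) j⌋ = ⌊x j + s - c (K s) j⌋ := by
      rw [Int.floor_eq_iff]
      have := Int.floor_add_fract (x j + s - c (K s) j)
      simp only [hl] at h1 h2
      constructor <;> linarith
    have hcov : Covers (c (K s)) (x + Pi.single j t) := by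
      have h3 : (fun i => ⌊(x + Pi.single j t : Fin n → ℝ) i - c (K s) i⌋) =
          fun i => ⌊(x + Pi.single j s : Fin n → ℝ) i - c (K s) i⌋ := by
        ext i
        by_cases hij : i = j
        · subst hij; simpa using hfl
        · simp [hij]
      rw [Covers, h3]
      exact hK s
    have hKK : K t = K s := (hKu t _ hcov).symm
    simp only [hl, hKK, Int.fract, hfl]
    ring
  obtain ⟨m, hm⟩ := exists_int_of_unit_intervals l
    (fun s => by simp only [hl]; linarith [Int.fract_nonneg (x j + s - c (K s) j)])
    (fun s => by simp only [hl]; linarith [Int.fract_lt_one (x j + s - c (K s) j)]) hloc s t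
  rw [hKu s k hk, hKu t k' hk', Int.fract_eq_fract]
  simp only [hl, Int.fract] at hm
  refine ⟨⌊x j + t - c (K t) j⌋ - ⌊x j + s - c (K s) j⌋ - m, ?_⟩
  push_cast
  linarith

/-- Round the coordinates with index in `S` down. -/
noncomputable def roundDown {n : ℕ} (S : Finset (Fin n)) (c : Fin n → ℝ) (i : Fin n) : ℝ :=
  if i ∈ S then ⌊c i⌋ else c i

theorem covers_roundDown_insert {n : ℕ} {S : Finset (Fin n)} {j : Fin n} (hj : j ∉ S)
    (c x : Fin n → ℝ) : Covers (roundDown (insert j S) c) x ↔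
      Covers (roundDown S c) (x + Pi.single j (Int.fract (c j))) := by
  have h : (fun i => ⌊x i - roundDown (insert j S) c i⌋) = fun i =>
      ⌊(x + Pi.single j (Int.fract (c j)) : Fin n → ℝ) i - roundDown S c i⌋ := by
    ext i
    by_cases hij : i = j
    · subst hij
      congr 1
      simp only [roundDown, Finset.mem_insert_self, if_true, hj, if_false, Pi.add_apply,
        Pi.single_eq_same, Int.fract]
      ring
    · simp [roundDown, hij]
  rw [Covers, h, Covers]

/-- Undoing the rounding of coordinate `j` moves points only in direction `j`, so both crosses meet
one line of the partition in which `j` is not yet rounded. -/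
theorem IsPartition.fract_eq_of_roundDown {n : ℕ} {ι : Type*} {c : ι → Fin n → ℝ}
    {S : Finset (Fin n)} (hS : IsPartition fun k => roundDown S (c k)) {j : Fin n} (hj : j ∉ S)
    (x : Fin n → ℝ) {t : ℝ} {k k' : ι} (hk : Covers (roundDown (insert j S) (c k)) x)
    (hk' : Covers (roundDown (insert j S) (c k')) (x + Pi.single j t)) :
    Int.fract (c k j) = Int.fract (c k' j) := by
  rw [covers_roundDown_insert hj] at hk hk'
  rw [add_assoc, ← Pi.single_add] at hk'
  simpa [roundDown, hj] using hS.fract_eq j x hk hk'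

/-- Crosses meeting a common line in direction `j` have the same fractional part there, so on that
line rounding is a translation. -/
theorem IsPartition.roundDown {n : ℕ} {ι : Type*} {c : ι → Fin n → ℝ} (hc : IsPartition c)
    (S : Finset (Fin n)) : IsPartition fun k => roundDown S (c k) := by
  induction S using Finset.induction_on with
  | empty =>
    have : (fun k => CrossTiling.roundDown ∅ (c k)) = c := by
      ext k i
      simp [CrossTiling.roundDown]
    rwa [this]
  | insert j S hj ih =>
    intro x
    obtain ⟨k₀, hk₀, -⟩ := ih x
    obtain ⟨k, hk, -⟩ := ih (x + Pi.single j (Int.fract (c k₀ j)))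
    have h1 := ih.fract_eq j x (s := 0) (by simpa using hk₀) hk
    simp only [CrossTiling.roundDown, hj, if_false] at h1
    refine ⟨k, (covers_roundDown_insert hj _ _).2 (by rw [← h1]; exact hk), fun k' hk' => ?_⟩
    have hk1 : Covers (CrossTiling.roundDown (insert j S) (c k)) x :=
      (covers_roundDown_insert hj _ _).2 (by rw [← h1]; exact hk)
    have h2 := ih.fract_eq_of_roundDown hj x (t := 0) hk1 (by simpa using hk')
    rw [covers_roundDown_insert hj] at hk1
    have hk2 := (covers_roundDown_insert hj _ _).1 hk'
    rw [← h2] at hk2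
    exact (ih _).unique hk2 hk1

theorem covers_roundDown_univ {n : ℕ} (c : Fin n → ℝ) (x : Fin n → ℤ) :
    Covers (roundDown Finset.univ c) (fun i => (x i : ℝ)) ↔ (x - fun i => ⌊c i⌋) ∈ ball n := by
  have h : (fun i => ⌊(x i : ℝ) - roundDown Finset.univ c i⌋) = x - fun i => ⌊c i⌋ := by
    ext i
    simp only [roundDown, Finset.mem_univ, if_true, Pi.sub_apply, ← Int.cast_sub, Int.floor_intCast]
  rw [Covers, h]

theorem IsPartition.fract_eq_of_sub_floor_mem_ball {n : ℕ} {ι : Type*} {c : ι → Fin n → ℝ}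
    (hc : IsPartition c) {j : Fin n} {x : Fin n → ℤ} {t : ℤ} {k k' : ι}
    (hk : (x - fun i => ⌊c k i⌋) ∈ ball n)
    (hk' : (x + Pi.single j t - fun i => ⌊c k' i⌋) ∈ ball n) :
    Int.fract (c k j) = Int.fract (c k' j) := by
  -- Coordinate `j` is rounded last, so that its fractional part is still visible in the preceding
  -- partition.
  obtain ⟨S, hj, hS⟩ : ∃ S : Finset (Fin n), j ∉ S ∧ insert j S = Finset.univ :=
    ⟨Finset.univ.erase j, Finset.notMem_erase _ _, Finset.insert_erase (Finset.mem_univ j)⟩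
  rw [← covers_roundDown_univ, ← hS] at hk hk'
  have h : (fun i => (((x + Pi.single j t : Fin n → ℤ) i : ℤ) : ℝ)) =
      (fun i => (x i : ℝ)) + Pi.single j (t : ℝ) := by
    ext i
    by_cases hij : i = j
    · subst hij; simp
    · simp [hij]
  rw [h] at hk'
  exact (hc.roundDown S).fract_eq_of_roundDown hj _ hk hk'

open Classical in
/-- Partitions of five-dimensional space into half-open crosses are translates of partitions
with integral corners, and linear. -/
theorem IsPartition.exists_linear {ι : Type*} {c : ι → Fin 5 → ℝ} (hc : IsPartition c) :
    ∃ (r : Fin 5 → ℝ) (a : Fin 5 → ZMod 11),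
      (∀ y, y ∈ Set.range c ↔ ∃ z : Fin 5 → ℤ, ∑ i, a i * z i = 0 ∧ y = fun i => r i + z i) ∧
      (∀ i, a i ≠ 0) ∧ ∀ i j, i ≠ j → a i ≠ a j ∧ a i ≠ -a j := by
  set m : ι → Fin 5 → ℤ := fun k i => ⌊c k i⌋ with hm
  have hint : ∀ x, ∃! k, x - m k ∈ ball 5 := fun x => by
    simpa only [covers_roundDown_univ] using hc.roundDown Finset.univ fun i => (x i : ℝ)
  have hT : ∀ x, ((ball 5).filter fun v => x - v ∈ Set.range m).card = 1 := by
    intro x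
    obtain ⟨k, hk, hu⟩ := hint x
    refine Finset.card_eq_one.2 ⟨x - m k, Finset.eq_singleton_iff_unique_mem.2
      ⟨Finset.mem_filter.2 ⟨hk, k, by abel⟩, fun v hv => ?_⟩⟩
    obtain ⟨hv, k', hk'⟩ := Finset.mem_filter.1 hv
    have : x - m k' = v := by rw [hk']; abel
    rw [← hu k' (show x - m k' ∈ ball 5 by rwa [this]), this]
  obtain ⟨a, d, hlin, ha0, ha⟩ := perfect_code_linear (Set.range m) hT
  have : Fact (Nat.Prime 11) := ⟨by norm_num⟩
  choose κ hκ hκu using hint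
  simp only at hκ hκu
  have hκm : ∀ k, ∀ v ∈ ball 5, κ (m k + v) = k := fun k v hv =>
    (hκu _ _ (by rwa [add_sub_cancel_left])).symm
  have hconst : ∀ j k k', Int.fract (c k j) = Int.fract (c k' j) := by
    intro j
    have hline : ∀ x (t : ℤ), Int.fract (c (κ (x + Pi.single j t)) j) = Int.fract (c (κ x) j) := by
      intro x t
      exact (hc.fract_eq_of_sub_floor_mem_ball (hκ x) (hκ (x + Pi.single j t))).symm
    -- As `a j` is invertible, the `j`-line through `x` contains a code point `m k`. The point `m k
    -- + e i` belongs to the same cross, which links this line to the one through `x + e i`.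
    have hstep : ∀ x i, Int.fract (c (κ (x + Pi.single i 1)) j) = Int.fract (c (κ x) j) := by
      intro x i
      obtain ⟨t, k, hk⟩ : ∃ t : ℤ, x + Pi.single j t ∈ Set.range m := by
        have hadd : ∀ t : ℤ, ∑ i, a i * ((x + Pi.single j t : Fin 5 → ℤ) i : ℤ) =
            ∑ i, a i * x i + a j * t := by
          intro t
          simp only [Pi.add_apply, Int.cast_add, mul_add, Finset.sum_add_distrib]
          rw [Finset.sum_eq_single (a := j) (f := fun i => a i * ((Pi.single j t : Fin 5 → ℤ) i : ℤ))
            (fun i _ hi => by simp [hi]) (by simp), Pi.single_eq_same]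
        refine ⟨((d - ∑ i, a i * x i) / a j).cast, (hlin _).2 ?_⟩
        rw [hadd, ZMod.intCast_zmod_cast, mul_div_cancel₀ _ (ha0 j), add_sub_cancel]
      rw [← hline x t, ← hline (x + Pi.single i 1) t, add_right_comm, ← hk,
        hκm k _ (single_one_mem_ball i)]
      have := hκm k 0 zero_mem_ball
      rw [add_zero] at this
      rw [this]
    have h0 : ∀ k, Int.fract (c k j) = Int.fract (c (κ 0) j) := by
      intro k
      have := eq_of_add_single_one_eq (fun x => Int.fract (c (κ x) j)) hstep (m k + 0)
      simpa only [hκm k 0 zero_mem_ball] using this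
    intro k k'
    rw [h0, h0 k']
  set k₀ := κ 0
  have hd : ∑ i, a i * m k₀ i = d := (hlin _).1 ⟨k₀, rfl⟩
  have hform : ∀ k i, c k i = c k₀ i + ((m k i - m k₀ i : ℤ) : ℝ) := by
    intro k i
    have h1 := hconst i k k₀
    simp only [Int.fract] at h1
    push_cast [hm]
    linarith
  refine ⟨c k₀, a, fun y => ⟨?_, ?_⟩, ha0, ha⟩
  · rintro ⟨k, rfl⟩
    refine ⟨m k - m k₀, ?_, funext fun i => hform k i⟩
    have h1 := (hlin _).1 ⟨k, rfl⟩
    simp only [Pi.sub_apply, Int.cast_sub, mul_sub, Finset.sum_sub_distrib]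
    rw [h1, hd, sub_self]
  · rintro ⟨z, hz, rfl⟩
    obtain ⟨k, hk⟩ : m k₀ + z ∈ Set.range m := by
      rw [hlin]
      simp only [Pi.add_apply, Int.cast_add, mul_add, Finset.sum_add_distrib]
      rw [hd, hz, add_zero]
    refine ⟨k, funext fun i => ?_⟩
    rw [hform, hk, Pi.add_apply, add_sub_cancel_left]

/-! ### From tilings by closed crosses to partitions into half-open crosses -/

section Geometry

theorem eventually_lt_of_pos {δ : ℝ} (hδ : 0 < δ) : ∀ᶠ ε in 𝓝[>] (0 : ℝ), ε < δ :=
  nhdsWithin_le_nhds (Iio_mem_nhds hδ)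

variable {n : ℕ} (b : OrthonormalBasis (Fin n) ℝ (Space n))

theorem mem_unitCube {b : OrthonormalBasis (Fin n) ℝ (Space n)} {c x : Space n} :
    x ∈ unitCube b c ↔ ∀ i, |b.repr x i - b.repr c i| ≤ 1 / 2 := by
  simp [unitCube, inner_sub_right, OrthonormalBasis.repr_apply_apply]

theorem mem_cross {b : OrthonormalBasis (Fin n) ℝ (Space n)} {c x : Space n} :
    x ∈ cross b c ↔ ∃ v ∈ ball n, ∀ i, |b.repr x i - b.repr c i - v i| ≤ 1 / 2 := by
  have hadd : ∀ j, x ∈ unitCube b (c + b j) ↔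
      ∀ i, |b.repr x i - b.repr c i - (Pi.single j 1 : Fin n → ℤ) i| ≤ 1 / 2 := fun j => by
    rw [mem_unitCube]
    refine forall_congr' fun i => ?_
    rw [map_add, b.repr_self, PiLp.add_apply, PiLp.single_apply, Pi.single_apply,
      sub_add_eq_sub_sub]
    push_cast
    rfl
  have hsub : ∀ j, x ∈ unitCube b (c - b j) ↔
      ∀ i, |b.repr x i - b.repr c i - (Pi.single j (-1) : Fin n → ℤ) i| ≤ 1 / 2 := fun j => by
    rw [mem_unitCube]
    refine forall_congr' fun i => ?_
    rw [map_sub, b.repr_self, PiLp.sub_apply, PiLp.single_apply, Pi.single_neg,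
      Pi.neg_apply, Pi.single_apply, sub_sub_eq_add_sub, Int.cast_neg, sub_neg_eq_add,
      add_sub_right_comm]
    push_cast
    rfl
  rw [cross, Set.mem_union, Set.mem_iUnion, mem_unitCube]
  constructor
  · rintro (h | ⟨j, h | h⟩)
    · exact ⟨0, zero_mem_ball, by simpa using h⟩
    · exact ⟨_, single_one_mem_ball j, (hadd j).1 h⟩
    · exact ⟨_, single_neg_one_mem_ball j, (hsub j).1 h⟩
  · rintro ⟨v, hv, h⟩
    obtain rfl | ⟨j, rfl | rfl⟩ := mem_ball.1 hv
    · exact Or.inl (by simpa using h)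
    · exact Or.inr ⟨j, Or.inl ((hadd j).2 h)⟩
    · exact Or.inr ⟨j, Or.inr ((hsub j).2 h)⟩

/-- The smallest corner of the central cube, in coordinates. -/
noncomputable def corner (c : Space n) (i : Fin n) : ℝ := b.repr c i - 1 / 2

/-- The sum of the vectors of an orthonormal basis. -/
noncomputable def diagonal : Space n := b.repr.symm (WithLp.toLp 2 fun _ => 1)

theorem repr_add_smul_diagonal (x : Space n) (ε : ℝ) (i : Fin n) :
    b.repr (x + ε • diagonal b) i = b.repr x i + ε := by
  simp [diagonal]

/-- A small positive push along the diagonal keeps all floors and leaves every cube face, where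
closed and half-open cubes differ. -/
theorem covers_of_mem_interior {b : OrthonormalBasis (Fin n) ℝ (Space n)} {c x : Space n}
    (hx : x ∈ interior (cross b c)) : Covers (corner b c) (b.repr x) := by
  have h1 : ∀ᶠ ε in 𝓝[>] (0 : ℝ), x + ε • diagonal b ∈ interior (cross b c) := by
    have hcont : Continuous fun ε : ℝ => x + ε • diagonal b := by fun_prop
    have h := hcont.tendsto 0
    rw [zero_smul, add_zero] at h
    exact (h.eventually (isOpen_interior.mem_nhds hx)).filter_mono nhdsWithin_le_nhds
  have h2 : ∀ᶠ ε in 𝓝[>] (0 : ℝ), ∀ i, ε < 1 - Int.fract (b.repr x i - corner b c i) :=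
    eventually_all.2 fun i => eventually_lt_of_pos (sub_pos.2 (Int.fract_lt_one _))
  obtain ⟨ε, h1, h2, h3⟩ := (h1.and (h2.and self_mem_nhdsWithin)).exists
  obtain ⟨v, hv, h⟩ := mem_cross.1 (interior_subset h1)
  have : (fun i => ⌊b.repr x i - corner b c i⌋) = v := by
    ext i
    have h4 := abs_le.1 (h i)
    have h5 := h2 i
    rw [repr_add_smul_diagonal] at h4
    have h6 := Int.floor_add_fract (b.repr x i - corner b c i)
    have h7 := Int.fract_nonneg (b.repr x i - corner b c i)
    have h3 : 0 < ε := h3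
    have h8 : corner b c i = b.repr c i - 1 / 2 := rfl
    have l1 : (v i : ℝ) < ⌊b.repr x i - corner b c i⌋ + 1 := by linarith
    have l2 : (⌊b.repr x i - corner b c i⌋ : ℝ) < v i + 1 := by linarith
    exact le_antisymm (Int.lt_add_one_iff.1 (by exact_mod_cast l2))
      (Int.lt_add_one_iff.1 (by exact_mod_cast l1))
  rw [Covers, this]
  exact hv

theorem mem_interior_cross {b : OrthonormalBasis (Fin n) ℝ (Space n)} {c x : Space n}
    {v : Fin n → ℤ} (hv : v ∈ ball n) (h : ∀ i, |b.repr x i - b.repr c i - v i| < 1 / 2) :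
    x ∈ interior (cross b c) := by
  refine mem_interior.2 ⟨{z | ∀ i, |b.repr z i - b.repr c i - v i| < 1 / 2},
    fun z hz => mem_cross.2 ⟨v, hv, fun i => (hz i).le⟩, ?_, h⟩
  rw [Set.ofPred_forall]
  refine isOpen_iInter_of_finite fun i => isOpen_lt ?_ continuous_const
  have : Continuous fun z => b.repr z i :=
    (EuclideanSpace.proj i).continuous.comp b.repr.continuous
  fun_prop

theorem eventually_mem_interior {b : OrthonormalBasis (Fin n) ℝ (Space n)} {c x : Space n}
    (hx : Covers (corner b c) (b.repr x)) :
    ∀ᶠ ε in 𝓝[>] (0 : ℝ), x + ε • diagonal b ∈ interior (cross b c) := by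
  have h2 : ∀ᶠ ε in 𝓝[>] (0 : ℝ), ∀ i, ε < 1 - Int.fract (b.repr x i - corner b c i) :=
    eventually_all.2 fun i => eventually_lt_of_pos (sub_pos.2 (Int.fract_lt_one _))
  filter_upwards [h2, self_mem_nhdsWithin] with ε h2 h3
  refine mem_interior_cross hx fun i => ?_
  have h3 : 0 < ε := h3
  have h4 := h2 i
  have h6 := Int.floor_add_fract (b.repr x i - corner b c i)
  have h7 := Int.fract_nonneg (b.repr x i - corner b c i)
  rw [repr_add_smul_diagonal, abs_lt]
  simp only [corner] at *
  constructor <;> linarith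

/-- Uniqueness: a small diagonal push takes a doubly covered point into two interiors. Existence:
only finitely many crosses come near a point, so one cube of one of them contains its pushes for
arbitrarily small `ε`, and the half-open cube then contains the point. -/
theorem isPartition_corner {L : Set (Set (Space n))} (hL : IsCrossTiling L)
    {b : OrthonormalBasis (Fin n) ℝ (Space n)} (c : L → Space n)
    (hc : ∀ K : L, (K : Set (Space n)) = cross b (c K)) : IsPartition fun K => corner b (c K) := by
  have hdisj : ∀ (K K' : L) x, x ∈ interior (cross b (c K)) → x ∈ interior (cross b (c K')) →
      K = K' := by
    intro K K' x hx hx'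
    by_contra hne
    rw [← hc] at hx hx'
    exact Set.disjoint_left.1 (hL.disjoint K K.2 K' K'.2 fun h => hne (Subtype.ext h)) hx hx'
  have hinj : Function.Injective fun (K : L) i => ⌊b.repr (c K) i⌋ := by
    intro K K' h
    have hlt : ∀ i, |b.repr (c K) i - b.repr (c K') i| < 1 := fun i =>
      Int.abs_sub_lt_one_of_floor_eq_floor (congrFun h i)
    -- Centres with equal floors are so close that their midpoint is interior to both central cubes.
    refine hdisj K K' ((1 / 2 : ℝ) • (c K + c K')) ?_ ?_ <;>
    · refine mem_interior_cross zero_mem_ball fun i => ?_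
      have := abs_lt.1 (hlt i)
      simp only [map_smul, map_add, PiLp.smul_apply, PiLp.add_apply, smul_eq_mul, Pi.zero_apply,
        Int.cast_zero, sub_zero]
      rw [abs_lt]
      constructor <;> linarith
  intro y
  obtain ⟨x, hx⟩ : ∃ x : Space n, ∀ i, b.repr x i = y i :=
    ⟨b.repr.symm (WithLp.toLp 2 y), fun i => by simp⟩
  have hy : y = b.repr x := funext fun i => (hx i).symm
  refine existsUnique_of_exists_of_unique ?_ fun K K' h h' => ?_
  -- The bound 3 exceeds the half side 1/2 plus an offset of at most 1 plus `ε < 1`.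
  · set F : Set L := {K | ∀ i, |b.repr x i - b.repr (c K) i| ≤ 3} with hF
    have hfin : F.Finite := by
      refine ((Set.finite_Icc (fun i => ⌊y i - 3⌋) (fun i => ⌊y i + 3⌋)).preimage
        hinj.injOn).subset fun K hK => ?_
      constructor <;> intro i <;> refine Int.floor_le_floor ?_ <;>
      · have := abs_le.1 (hK i)
        rw [hx] at this
        linarith
    have hex : ∀ᶠ ε in 𝓝[>] (0 : ℝ), ∃ K ∈ F, ∃ v ∈ ball n,
        ∀ i, |b.repr x i + ε - b.repr (c K) i - v i| ≤ 1 / 2 := by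
      have hlt : ∀ᶠ ε in 𝓝[>] (0 : ℝ), ε < 1 :=
        eventually_lt_of_pos one_pos
      filter_upwards [hlt, self_mem_nhdsWithin] with ε h1 h0
      have h0 : 0 < ε := h0
      have hmem : x + ε • diagonal b ∈ ⋃₀ L := hL.covers ▸ Set.mem_univ _
      obtain ⟨K, hK, hxK⟩ := hmem
      rw [show K = _ from hc ⟨K, hK⟩] at hxK
      obtain ⟨v, hv, h⟩ := mem_cross.1 hxK
      simp only [repr_add_smul_diagonal] at h
      refine ⟨⟨K, hK⟩, fun i => ?_, v, hv, h⟩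
      have h2 := abs_le.1 (h i)
      have h3 : -1 ≤ v i ∧ v i ≤ 1 := by
        obtain rfl | ⟨j, rfl | rfl⟩ := mem_ball.1 hv
        · simp
        · rw [Pi.single_apply]; split_ifs <;> simp
        · rw [Pi.single_apply]; split_ifs <;> simp
      have h4 : (-1 : ℝ) ≤ v i := by exact_mod_cast h3.1
      have h5 : (v i : ℝ) ≤ 1 := by exact_mod_cast h3.2
      rw [abs_le]
      constructor <;> linarith
    obtain ⟨K, v, hv, hfreq⟩ : ∃ K, ∃ v ∈ ball n, ∃ᶠ ε in 𝓝[>] (0 : ℝ),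
        ∀ i, |b.repr x i + ε - b.repr (c K) i - v i| ≤ 1 / 2 := by
      by_contra hno
      have h1 : ∀ᶠ ε in 𝓝[>] (0 : ℝ), ∀ K ∈ F, ∀ v ∈ ball n,
          ¬ ∀ i, |b.repr x i + ε - b.repr (c K) i - v i| ≤ 1 / 2 :=
        (eventually_all_finite hfin).2 fun K _ => (eventually_all_finset _).2 fun v hv =>
          not_frequently.1 fun hf => hno ⟨K, v, hv, hf⟩
      obtain ⟨ε, ⟨K, hK, v, hv, h⟩, h'⟩ := (hex.and h1).exists
      exact h' K hK v hv h
    refine ⟨K, ?_⟩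
    have : (fun i => ⌊y i - corner b (c K) i⌋) = v := by
      ext i
      rw [Int.floor_eq_iff]
      simp only [corner]
      constructor
      · by_contra! hlt
        have hδ : ∀ᶠ ε in 𝓝[>] (0 : ℝ), ε < v i - (y i - (b.repr (c K) i - 1 / 2)) :=
          eventually_lt_of_pos (sub_pos.2 hlt)
        obtain ⟨ε, h1, h2⟩ := (hfreq.and_eventually hδ).exists
        have h3 := abs_le.1 (h1 i)
        rw [hx] at h3
        linarith
      · obtain ⟨ε, h1, h2⟩ := (hfreq.and_eventually self_mem_nhdsWithin).exists
        have h2 : 0 < ε := h2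
        have h3 := abs_le.1 (h1 i)
        rw [hx] at h3
        linarith
    rw [Covers, this]
    exact hv
  · rw [hy] at h h'
    obtain ⟨ε, h1, h2⟩ := ((eventually_mem_interior h).and (eventually_mem_interior h')).exists
    exact hdisj K K' _ h1 h2

end Geometry

/-! ### Isometries and signed permutations of the axes -/

section Isometry

variable {n : ℕ}

theorem image_unitCube {b b' : OrthonormalBasis (Fin n) ℝ (Space n)}
    (g : Space n ≃ᵃⁱ[ℝ] Space n) (hg : ∀ i, g.linearIsometryEquiv (b i) = b' i) (c : Space n) :
    g '' unitCube b c = unitCube b' (g c) := by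
  ext y
  obtain ⟨x, rfl⟩ := g.surjective y
  rw [g.injective.mem_set_image]
  refine forall_congr' fun i => ?_
  have : g x - g c = g.linearIsometryEquiv (x - c) := by
    have := g.map_vsub x c
    simpa using this.symm
  rw [this, ← hg, LinearIsometryEquiv.inner_map_map]

theorem image_cross {b b' : OrthonormalBasis (Fin n) ℝ (Space n)}
    (g : Space n ≃ᵃⁱ[ℝ] Space n) (hg : ∀ i, g.linearIsometryEquiv (b i) = b' i) (c : Space n) :
    g '' cross b c = cross b' (g c) := by
  have hadd : ∀ v, g (c + v) = g c + g.linearIsometryEquiv v := fun v => by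
    have := g.map_vadd c v
    simp only [vadd_eq_add] at this
    rw [add_comm, this, add_comm]
  simp only [cross, Set.image_union, Set.image_iUnion, image_unitCube g hg, hadd, hg,
    sub_eq_add_neg, map_neg]

theorem cross_reindex (b : OrthonormalBasis (Fin n) ℝ (Space n)) (σ : Equiv.Perm (Fin n))
    (c : Space n) : cross (b.reindex σ) c = cross b c := by
  have h : ∀ c, unitCube (b.reindex σ) c = unitCube b c := fun c => by
    ext x
    simp only [unitCube, Set.mem_ofPred_eq, OrthonormalBasis.reindex_apply]
    exact σ.symm.forall_congr_right (q := fun i => |inner ℝ (b i) (x - c)| ≤ 1 / 2)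
  simp only [cross, h, OrthonormalBasis.reindex_apply]
  congr 1
  exact σ.symm.surjective.iUnion_comp fun i => unitCube b (c + b i) ∪ unitCube b (c - b i)

theorem cross_signs {b b' : OrthonormalBasis (Fin n) ℝ (Space n)}
    (h : ∀ i, b' i = b i ∨ b' i = -b i) (c : Space n) : cross b' c = cross b c := by
  have hcube : ∀ c, unitCube b' c = unitCube b c := fun c => by
    ext x
    refine forall_congr' fun i => ?_
    rcases h i with h | h <;> rw [h]
    rw [inner_neg_left, abs_neg]
  simp only [cross, hcube]
  congr 1
  refine Set.iUnion_congr fun i => ?_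
  rcases h i with h | h <;> rw [h]
  rw [sub_neg_eq_add, ← sub_eq_add_neg, Set.union_comm]

theorem exists_basis_signs (b : OrthonormalBasis (Fin n) ℝ (Space n)) (s : Fin n → ℝ)
    (hs : ∀ i, s i = 1 ∨ s i = -1) :
    ∃ b' : OrthonormalBasis (Fin n) ℝ (Space n), ∀ i, b' i = s i • b i := by
  have hon : Orthonormal ℝ fun i => s i • b i := by
    refine ⟨fun i => ?_, fun i j hij => ?_⟩
    · rw [norm_smul, b.norm_eq_one, mul_one]
      rcases hs i with h | h <;> simp [h]
    · change inner ℝ (s i • b i) (s j • b j) = 0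
      rw [inner_smul_left, inner_smul_right, b.inner_eq_zero hij]
      simp
  have hsp := hon.linearIndependent.span_eq_top_of_card_eq_finrank' (by simp)
  exact ⟨OrthonormalBasis.mk hon hsp.ge, fun i => by simp⟩

end Isometry

/-! ### The linear tiling of five-dimensional space -/

/-- The linear form `x₀ + 2 x₁ + 3 x₂ + 4 x₃ + 5 x₄` modulo eleven. -/
def weight : (Fin 5 → ℤ) →+ ZMod 11 where
  toFun x := ∑ i : Fin 5, ((i : ℕ) + 1 : ZMod 11) * (x i : ZMod 11)
  map_zero' := by simp
  map_add' x y := by simp [mul_add, Finset.sum_add_distrib]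

theorem weight_apply (x : Fin 5 → ℤ) :
    weight x = ∑ i : Fin 5, ((i : ℕ) + 1 : ZMod 11) * (x i : ZMod 11) := rfl

/-- The weights on the ball are `0, ±1, …, ±5`, each residue modulo eleven once. Existence gives
covering, injectivity gives disjointness. -/
theorem exists_mem_ball_weight : ∀ s : ZMod 11, ∃ v ∈ ball 5, weight v = s := by
  decide +kernel

theorem weight_injOn_ball : ∀ v ∈ ball 5, ∀ w ∈ ball 5, weight v = weight w → v = w := by
  decide +kernel

/-- The vector of `ℝ⁵` with the given integral coordinates. -/
noncomputable def intVec : (Fin 5 → ℤ) →+ Space 5 where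
  toFun z := WithLp.toLp 2 fun i => (z i : ℝ)
  map_zero' := by ext; simp
  map_add' x y := by ext; simp

theorem intVec_apply (z : Fin 5 → ℤ) (i : Fin 5) : intVec z i = z i := rfl

/-- The lattice of centres of the linear tiling. -/
noncomputable def centres : Submodule ℤ (Space 5) :=
  AddSubgroup.toIntSubmodule (weight.ker.map intVec)

instance discreteTopology_centres : DiscreteTopology centres := by
  have hle : (centres : Set (Space 5)) ⊆
      Submodule.span ℤ (Set.range (stdBasis 5).toBasis) := by
    rintro x ⟨z, -, rfl⟩
    rw [SetLike.mem_coe, Module.Basis.mem_span_iff_repr_mem]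
    exact fun i => ⟨z i, by simp [intVec_apply]⟩
  exact DiscreteTopology.of_subset (inferInstanceAs
    (DiscreteTopology (Submodule.span ℤ (Set.range (stdBasis 5).toBasis)))) hle

/-- The lattice contains eleven times each standard basis vector. -/
theorem isZLattice_centres : IsZLattice ℝ centres := by
  refine ⟨eq_top_iff.2 ?_⟩
  rw [← (stdBasis 5).toBasis.span_eq, Submodule.span_le]
  rintro _ ⟨i, rfl⟩
  have h : intVec (Pi.single i 11) ∈ centres := by
    refine ⟨Pi.single i 11, ?_, rfl⟩
    change weight (Pi.single i 11) = 0
    revert i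
    decide +kernel
  have h2 : (stdBasis 5).toBasis i = (1 / 11 : ℝ) • intVec (Pi.single i 11) := by
    ext j
    by_cases hij : j = i
    · subst hij; simp [intVec_apply]
    · simp [intVec_apply, hij]
  rw [h2]
  exact Submodule.smul_mem _ _ (Submodule.subset_span h)

/-- The linear tiling. -/
def linearTiling : Set (Set (Space 5)) := cross (stdBasis 5) '' (centres : Set (Space 5))

theorem isCrossTiling_linearTiling : IsCrossTiling linearTiling where
  isCross := ⟨stdBasis 5, by rintro _ ⟨c, -, rfl⟩; exact ⟨c, rfl⟩⟩
  covers := by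
    refine Set.eq_univ_of_forall fun x => ?_
    -- The integer point whose unit cube contains `x`.
    set m : Fin 5 → ℤ := fun i => round (x i) with hm
    obtain ⟨v, hv, hw⟩ := exists_mem_ball_weight (weight m)
    refine ⟨_, ⟨intVec (m - v), ⟨m - v, ?_, rfl⟩, rfl⟩, mem_cross.2 ⟨v, hv, fun i => ?_⟩⟩
    · exact (map_sub weight m v).trans (sub_eq_zero.2 hw.symm)
    · have := abs_sub_round (x i)
      have h : (stdBasis 5).repr x i - (stdBasis 5).repr (intVec (m - v)) i - v i =
          x i - round (x i) := by
        simp only [intVec_apply, EuclideanSpace.basisFun_repr, Pi.sub_apply, Int.cast_sub, hm]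
        ring
      rwa [h]
  disjoint := by
    rintro _ ⟨_, ⟨z, hz, rfl⟩, rfl⟩ _ ⟨_, ⟨w, hw, rfl⟩, rfl⟩ hne
    rw [Set.disjoint_left]
    intro x hx hx'
    refine hne ?_
    have h : ∀ z, x ∈ interior (cross (stdBasis 5) (intVec z)) →
        ((fun i => ⌊x i + 1 / 2⌋) - z) ∈ ball 5 := by
      intro z hx
      have h1 := covers_of_mem_interior hx
      have h2 : (fun i => ⌊x i + 1 / 2⌋) - z =
          fun i => ⌊(stdBasis 5).repr x i - corner (stdBasis 5) (intVec z) i⌋ := by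
        ext i
        rw [Pi.sub_apply, ← Int.floor_sub_intCast]
        congr 1
        simp only [corner, EuclideanSpace.basisFun_repr, intVec_apply]
        ring
      rw [h2]
      exact h1
    have hzw := weight_injOn_ball _ (h z hx) _ (h w hx') (by
      rw [map_sub, map_sub, show weight z = 0 from hz, show weight w = 0 from hw])
    rw [sub_right_inj.1 hzw]

theorem isZTiling_linearTiling : IsZTiling linearTiling where
  isCrossTiling := isCrossTiling_linearTiling
  integer := by
    rintro _ ⟨_, ⟨z, -, rfl⟩, rfl⟩
    exact ⟨intVec z, fun i => ⟨z i, rfl⟩, rfl⟩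

theorem isLatticeTiling_linearTiling : IsLatticeTiling linearTiling where
  isCrossTiling := isCrossTiling_linearTiling
  lattice := ⟨stdBasis 5, centres, inferInstance, isZLattice_centres, rfl⟩

/-! ### Uniqueness -/

/-- The nonzero residues form five classes up to sign, represented by `1, …, 5`; five coefficients
in distinct classes use each once. -/
theorem exists_signed_perm (a : Fin 5 → ZMod 11) (h0 : ∀ i, a i ≠ 0)
    (h : ∀ i j, i ≠ j → a i ≠ a j ∧ a i ≠ -a j) :
    ∃ (σ : Equiv.Perm (Fin 5)) (s : Fin 5 → ℤ), (∀ i, s i = 1 ∨ s i = -1) ∧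
      ∀ i, a i = s i * ((σ i : ℕ) + 1) := by
  have hall : ∀ x : ZMod 11, x ≠ 0 → ∃ k : Fin 5, x = (k : ℕ) + 1 ∨ x = -((k : ℕ) + 1) := by
    decide
  choose f hf using fun i => hall (a i) (h0 i)
  have hinj : Function.Injective f := by
    intro i j hij
    by_contra hne
    have h1 := hf i
    have h2 := hf j
    rw [hij] at h1
    obtain ⟨h3, h4⟩ := h i j hne
    rcases h1 with h1 | h1 <;> rcases h2 with h2 | h2 <;> simp [h1, h2] at h3 h4
  choose s hs hs' using fun i => show ∃ s : ℤ, (s = 1 ∨ s = -1) ∧ a i = s * ((f i : ℕ) + 1) by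
    rcases hf i with h | h
    · exact ⟨1, Or.inl rfl, by simpa using h⟩
    · exact ⟨-1, Or.inr rfl, by simpa using h⟩
  exact ⟨Equiv.ofBijective f (Finite.injective_iff_bijective.1 hinj), s, hs, hs'⟩

theorem congruent_linearTiling {L : Set (Set (Space 5))} (hL : IsCrossTiling L) :
    Congruent linearTiling L := by
  obtain ⟨b, hb⟩ := hL.isCross
  choose c hc using fun K : L => hb K K.2
  obtain ⟨r, a, hr, ha0, ha⟩ := (isPartition_corner hL c hc).exists_linear
  obtain ⟨σ, s, hs, has⟩ := exists_signed_perm a ha0 ha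
  have hss : ∀ i, s i * s i = 1 := fun i => by rcases hs i with h | h <;> rw [h] <;> rfl
  obtain ⟨b₁, hb₁⟩ := exists_basis_signs b (fun i => (s i : ℝ)) fun i => by
    rcases hs i with h | h <;> simp [h]
  have hcross : ∀ c, cross (b₁.reindex σ) c = cross b c := fun c => by
    rw [cross_reindex, cross_signs fun i => ?_]
    rw [hb₁]
    rcases hs i with h | h <;> simp [h]
  -- The summand 1/2 turns the corner `r` into a centre.
  obtain ⟨p, hp⟩ : ∃ p : Space 5, ∀ i, b.repr p i = r i + 1 / 2 :=
    ⟨b.repr.symm (WithLp.toLp 2 fun i => r i + 1 / 2), fun i => by simp⟩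
  -- `g` sends the origin to `p` and the direction `e (σ i)` to `s i • b i`, which turns `weight`
  -- into the form with coefficients `a`.
  set g : Space 5 ≃ᵃⁱ[ℝ] Space 5 :=
    (b₁.reindex σ).repr.symm.toAffineIsometryEquiv.trans (AffineIsometryEquiv.constVAdd ℝ _ p)
    with hg
  have himage : ∀ x, g '' cross (stdBasis 5) x = cross b (g x) := fun x => by
    rw [← hcross]
    refine image_cross g (fun i => ?_) x
    change (b₁.reindex σ).repr.symm (stdBasis 5 i) = _
    simp
  have hrepr : ∀ z i, b.repr (g (intVec z)) i = r i + 1 / 2 + ((s i * z (σ i) : ℤ) : ℝ) := by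
    intro z i
    have h1 : g (intVec z) = p + (b₁.reindex σ).repr.symm (intVec z) := by simp [hg]
    have h2 : ∀ y, b.repr y i = s i * (b₁.reindex σ).repr y (σ i) := by
      intro y
      rw [OrthonormalBasis.repr_apply_apply, OrthonormalBasis.repr_apply_apply,
        OrthonormalBasis.reindex_apply, Equiv.symm_apply_apply, hb₁, inner_smul_left, ← mul_assoc]
      have : (s i : ℝ) * s i = 1 := by exact_mod_cast hss i
      simp [this]
    rw [h1, map_add, PiLp.add_apply, hp, h2, LinearIsometryEquiv.apply_symm_apply, intVec_apply]
    push_cast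
    ring
  have hweight : ∀ z, ∑ i, a i * ((s i * z (σ i) : ℤ) : ZMod 11) = weight z := by
    intro z
    rw [weight_apply,
      ← Equiv.sum_comp σ fun i : Fin 5 => (((i : ℕ) : ZMod 11) + 1) * ((z i : ℤ) : ZMod 11)]
    refine Finset.sum_congr rfl fun i _ => ?_
    have : (s i : ZMod 11) * s i = 1 := by exact_mod_cast congrArg (Int.cast (R := ZMod 11)) (hss i)
    rw [has]
    push_cast
    linear_combination ((σ i : ℕ) + 1 : ZMod 11) * z (σ i) * this
  have hcorner : ∀ (x : Space 5) (z : Fin 5 → ℤ),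
      corner b x = (fun i => r i + ((s i * z (σ i) : ℤ) : ℝ)) ↔ g (intVec z) = x := by
    intro x z
    rw [funext_iff, ← b.repr.injective.eq_iff, PiLp.ext_iff]
    refine forall_congr' fun i => ?_
    rw [hrepr, corner]
    constructor <;> intro h <;> linarith
  refine ⟨g, Set.ext fun K => ⟨?_, fun hK => ?_⟩⟩
  · rintro ⟨_, ⟨_, ⟨z, hz, rfl⟩, rfl⟩, rfl⟩
    obtain ⟨K, hK⟩ := (hr fun i => r i + ((s i * z (σ i) : ℤ) : ℝ)).2
      ⟨fun i => s i * z (σ i), (hweight z).trans hz, rfl⟩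
    simp only [himage]
    rw [(hcorner _ z).1 hK, ← hc]
    exact K.2
  · obtain ⟨y, hy, hy'⟩ := (hr _).1 ⟨⟨K, hK⟩, rfl⟩
    have hz : ∀ i, s i * (fun j => s (σ.symm j) * y (σ.symm j)) (σ i) = y i := fun i => by
      simp only [Equiv.symm_apply_apply]
      rw [← mul_assoc, hss, one_mul]
    refine ⟨_, ⟨intVec fun j => s (σ.symm j) * y (σ.symm j), ⟨_, ?_, rfl⟩, rfl⟩, ?_⟩
    · refine (hweight _).symm.trans ?_
      simp only [hz]
      exact hy
    · have h1 := (hcorner (c ⟨K, hK⟩) fun j => s (σ.symm j) * y (σ.symm j)).1 (by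
        simp only [hz]
        exact hy')
      simp only [himage]
      rw [h1, ← hc]

end CrossTiling

theorem mainTheorem3 :
    ∃ T : Set (Set (CrossTiling.Space 5)),
      CrossTiling.IsCrossTiling T ∧ CrossTiling.IsZTiling T ∧ CrossTiling.IsLatticeTiling T ∧
        ∀ L : Set (Set (CrossTiling.Space 5)),
          CrossTiling.IsCrossTiling L → CrossTiling.Congruent T L :=
  ⟨CrossTiling.linearTiling, CrossTiling.isCrossTiling_linearTiling,
    CrossTiling.isZTiling_linearTiling, CrossTiling.isLatticeTiling_linearTiling,
    fun _ => CrossTiling.congruent_linearTiling⟩
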